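/- Let $n\ge 1$ and let $SO$ be a random element of the special orthogonal group $SO(2n)=\{A\in\mathbb{R}^{2n\times 2n}: AA^{T}=I_{2n},\ \det A=1\}$ whose law is the Haar probability measure $\mu_{SO(2n)}$. Then $$ \det(I_{2n}-SO)\ \overset{\text{law}}{=}\ 2\prod_{k=2}^{2n}\Bigl(1+\epsilon_k\sqrt{\beta_{\frac12,\frac{k-1}{2}}}\Bigr), $$ where $\epsilon_2,\dots,\epsilon_{2n},\beta_{\frac12,\frac12},\beta_{\frac12,1},\dots,\beta_{\frac12,\frac{2n-1}{2}}$ are (jointly) independent random variables, $\mathbb{P}(\epsilon_k=1)=\mathbb{P}(\epsilon_k=-1)=\frac12$, and $\beta_{a,b}$ has the Beta distribution with parameters $a,b$, i.e. density $\frac{\Gamma(a+b)}{\Gamma(a)\Gamma(b)}x^{a-1}(1-x)^{b-1}$ on $(0,1)$. Moreover (the Keating–Snaith moment formula for $SO(2n)$), for every $t\in\mathbb{C}$ with $\operatorname{Re} t>-\frac12$ the random variable $Z^t$, $Z:=\det(I_{2n}-SO)$, is integrable and $$ \mathbb{E}\bigl[Z^t\bigr]=2^{2nt}\prod_{k=1}^{n}\frac{\Gamma(n+k-1)\,\Gamma\bigl(t+k-\frac12\bigr)}{\Gamma\bigl(k-\frac12\bigr)\,\Gamma(t+k+n-1)}.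 $$ -/

import Mathlib

open MeasureTheory ProbabilityTheory

/-! Embed SO(N) in SO(N+1) as the stabiliser of the last basis vector. For S in SO(N+1) with last
diagonal entry s, and T in SO(N), a Schur complement gives det(1 + S T) = (1 + s) det(1 + S' T),
where S' in SO(N) depends on S alone (`det_one_add_fromBlocks_mul`). Take S and T independent and
Haar distributed: S T has the law of S by right invariance, and S' T has the law of T by left
invariance. So det(1 + S) is in law the product of independent copies of 1 + s and det(1 + T)
(`map_detOneAdd_succ`). Iterate down to SO(1), where the determinant is 2. In even dimension -1 is a
rotation, so 1 - S may replace 1 + S.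

In SO(k) with k ≥ 2 the entry s is a coordinate of a uniform point of the sphere. Its law is found
without densities: the recursion in `HasSphereMoments` determines a law on [-1, 1], and it holds for
s (by rotation invariance), for ε√β, and for 2x - 1 with x symmetric Beta. The last form turns the
complex moments of 1 + s into Beta integrals, and their product collapses by
`prod_range_div_duplication`. The identity in law follows from the same moments at natural
exponents, since bounded laws are determined by them. -/

open Matrix in
theorem mem_specialOrthogonalGroup_iff_mul_transpose {m : Type*} [Fintype m] [DecidableEq m]
    {A : Matrix m m ℝ} :
    A ∈ Matrix.specialOrthogonalGroup m ℝ ↔ A * Aᵀ = 1 ∧ A.det = 1 := by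
  rw [Matrix.mem_specialOrthogonalGroup_iff, Matrix.mem_orthogonalGroup_iff]

/-! ### Matrix identities: the Schur complement reduction and plane rotations. -/

namespace Matrix

variable {m : Type*} [Fintype m] [DecidableEq m]

theorem transpose_mul_self_of_mem {A : Matrix m m ℝ}
    (hA : A ∈ specialOrthogonalGroup m ℝ) : Aᵀ * A = 1 :=
  mul_eq_one_comm.mp (mem_specialOrthogonalGroup_iff_mul_transpose.mp hA).1

/-- The embedding of the smaller rotation group fixing the last basis vector. -/
noncomputable def extendLast (N : ℕ) (T : Matrix (Fin N) (Fin N) ℝ) :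
    Matrix (Fin (N + 1)) (Fin (N + 1)) ℝ :=
  reindex finSumFinEquiv finSumFinEquiv (fromBlocks T 0 0 (1 : Matrix (Fin 1) (Fin 1) ℝ))

theorem extendLast_mem {N : ℕ} {T : Matrix (Fin N) (Fin N) ℝ}
    (hT : T ∈ specialOrthogonalGroup (Fin N) ℝ) :
    extendLast N T ∈ specialOrthogonalGroup (Fin (N + 1)) ℝ := by
  rw [mem_specialOrthogonalGroup_iff_mul_transpose] at hT ⊢
  refine ⟨?_, ?_⟩
  · simp [extendLast, fromBlocks_transpose, submatrix_mul_equiv, fromBlocks_multiply, hT.1]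
  · simp [extendLast, hT.2]

/-- Eliminating the corner 1 + d leaves the Schur complement 1 + S' T with S' = A - b c / (1 + d),
and the block relations of S Sᵀ = 1 make S' orthogonal. That S' is chosen before T is what the
averaging argument needs. -/
theorem det_one_add_fromBlocks_mul {A : Matrix m m ℝ} {b : Matrix m (Fin 1) ℝ}
    {c : Matrix (Fin 1) m ℝ} {d : Matrix (Fin 1) (Fin 1) ℝ}
    (hS : fromBlocks A b c d ∈ specialOrthogonalGroup (m ⊕ Fin 1) ℝ) :
    ∃ S' ∈ specialOrthogonalGroup m ℝ, ∀ T : Matrix m m ℝ,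
      (1 + fromBlocks A b c d * fromBlocks T 0 0 1).det = (1 + d 0 0) * (1 + S' * T).det := by
  have h1 := hS
  rw [mem_specialOrthogonalGroup_iff_mul_transpose] at h1
  obtain ⟨h1, hdet⟩ := h1
  rw [fromBlocks_transpose, fromBlocks_multiply, ← fromBlocks_one, fromBlocks_inj] at h1
  obtain ⟨hAA, hAc, hcA, hcc⟩ := h1
  have hd : d = d 0 0 • (1 : Matrix (Fin 1) (Fin 1) ℝ) := by
    ext i j; fin_cases i; fin_cases j; simp
  set δ := d 0 0 with hδ
  have hprod : ∀ T : Matrix m m ℝ, 1 + fromBlocks A b c d * fromBlocks T 0 0 1 =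
      fromBlocks (1 + A * T) b (c * T) (1 + d) := by
    intro T
    rw [fromBlocks_multiply, ← fromBlocks_one, fromBlocks_add]
    simp
  by_cases hδ1 : δ = -1
  -- With corner -1 the unit last row forces c = 0; both sides vanish and any S' serves.
  · refine ⟨1, one_mem _, fun T => ?_⟩
    have hc : c = 0 := by
      have : (c * cᵀ) 0 0 = 0 := by
        have := congrFun (congrFun hcc 0) 0
        rw [hd, hδ1] at this
        simpa using this
      rw [mul_apply] at this
      simp only [transpose_apply] at this
      rw [Finset.sum_eq_zero_iff_of_nonneg (fun i _ => mul_self_nonneg _)] at this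
      ext i j
      fin_cases i
      simpa using this j (Finset.mem_univ _)
    rw [hprod, hc, hd, hδ1]
    simp
  have hδ2 : 1 + δ ≠ 0 := fun h => hδ1 (by linarith)
  have hD : (1 + d) = (1 + δ) • (1 : Matrix (Fin 1) (Fin 1) ℝ) := by
    rw [add_smul, one_smul, ← hd]
  set S' : Matrix m m ℝ := A - (1 + δ)⁻¹ • (b * c) with hS'
  have hdet₂₂ : ∀ (X : Matrix m m ℝ) (y : Matrix (Fin 1) m ℝ),
      (fromBlocks X b y (1 + d)).det = (1 + δ) * (X - (1 + δ)⁻¹ • (b * y)).det := by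
    intro X y
    have : Invertible (1 + d) := by
      rw [hD]
      exact ⟨(1 + δ)⁻¹ • 1, by simp [smul_smul, hδ2], by simp [smul_smul, hδ2]⟩
    rw [det_fromBlocks₂₂, invOf_eq_nonsing_inv, hD]
    have : ((1 + δ) • (1 : Matrix (Fin 1) (Fin 1) ℝ))⁻¹ = (1 + δ)⁻¹ • 1 :=
      inv_eq_left_inv (by simp [smul_smul, hδ2])
    rw [this]
    simp
  have hschur : ∀ T : Matrix m m ℝ, (fromBlocks (1 + A * T) b (c * T) (1 + d)).det =
      (1 + δ) * (1 + S' * T).det := by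
    intro T
    rw [hdet₂₂, hS', Matrix.sub_mul, Matrix.smul_mul, Matrix.mul_assoc, add_sub_assoc]
  refine ⟨S', ?_, fun T => by rw [hprod, hschur]⟩
  rw [mem_specialOrthogonalGroup_iff_mul_transpose]
  have hbb : b * bᵀ = 1 - A * Aᵀ := by rw [← hAA]; abel
  have hcT : c * Aᵀ = - δ • bᵀ := by
    rw [hd] at hcA
    simp only [smul_mul, Matrix.one_mul] at hcA
    rw [neg_smul]
    exact eq_neg_of_add_eq_zero_left hcA
  have hAcT : A * cᵀ = - δ • b := by
    have := congrArg transpose hcT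
    simpa using this
  have hcc' : c * cᵀ = (1 - δ ^ 2) • (1 : Matrix (Fin 1) (Fin 1) ℝ) := by
    rw [hd] at hcc
    simp only [transpose_smul, transpose_one, smul_mul, Matrix.one_mul, smul_smul] at hcc
    rw [sub_smul, one_smul, sq]
    exact eq_sub_of_add_eq hcc
  constructor
  · rw [hS', transpose_sub, transpose_smul, transpose_mul, sub_mul, mul_sub, mul_sub]
    simp only [Matrix.smul_mul, Matrix.mul_smul]
    rw [← Matrix.mul_assoc A, hAcT, Matrix.mul_assoc b c Aᵀ, hcT, Matrix.mul_assoc b c,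
      ← Matrix.mul_assoc c cᵀ, hcc']
    simp only [Matrix.smul_mul, Matrix.mul_smul, smul_smul, Matrix.one_mul]
    rw [hbb, show A * Aᵀ - ((1 + δ)⁻¹ * -δ) • (1 - A * Aᵀ) - (((1 + δ)⁻¹ * -δ) • (1 - A * Aᵀ)
      - ((1 + δ)⁻¹ * ((1 + δ)⁻¹ * (1 - δ ^ 2))) • (1 - A * Aᵀ)) =
      A * Aᵀ + (2 * (1 + δ)⁻¹ * δ + (1 + δ)⁻¹ * ((1 + δ)⁻¹ * (1 - δ ^ 2))) • (1 - A * Aᵀ) by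
        module]
    rw [show 2 * (1 + δ)⁻¹ * δ + (1 + δ)⁻¹ * ((1 + δ)⁻¹ * (1 - δ ^ 2)) = 1 by field_simp; ring]
    simp
  -- For det S' = 1, compute the determinant of S with 1 added to its corner in two ways: by Schur
  -- complement, and after multiplying by Sᵀ, which makes it block triangular.
  · have h5 : (fromBlocks A b c (1 + d)).det = (1 + δ) * S'.det := hdet₂₂ A c
    have h6 : (fromBlocks A b c (1 + d)).det = 1 + δ := by
      have h7 : fromBlocks A b c (1 + d) * (fromBlocks A b c d)ᵀ =
          fromBlocks 1 0 bᵀ (1 + d) := by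
        rw [fromBlocks_transpose, fromBlocks_multiply, Matrix.add_mul, Matrix.add_mul, hAA, hAc,
          Matrix.one_mul, Matrix.one_mul, add_left_comm, hcA, add_left_comm, hcc, add_zero, hd]
        simp [add_comm]
      have h8 := congrArg det h7
      rw [det_mul, det_transpose, hdet, det_fromBlocks_zero₁₂] at h8
      simpa using h8
    exact mul_left_cancel₀ hδ2 (by rw [← h5, h6, mul_one])

theorem det_one_add_mul_extendLast {N : ℕ} {S : Matrix (Fin (N + 1)) (Fin (N + 1)) ℝ}
    (hS : S ∈ specialOrthogonalGroup (Fin (N + 1)) ℝ) :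
    ∃ S' ∈ specialOrthogonalGroup (Fin N) ℝ, ∀ T : Matrix (Fin N) (Fin N) ℝ,
      (1 + S * extendLast N T).det = (1 + S (Fin.last N) (Fin.last N)) * (1 + S' * T).det := by
  set e : Fin N ⊕ Fin 1 ≃ Fin (N + 1) := finSumFinEquiv with he
  obtain ⟨B, hB⟩ : ∃ B, S = reindex e e B := ⟨reindex e.symm e.symm S, by ext; simp⟩
  obtain ⟨a, b, c, d, rfl⟩ : ∃ a b c d, B = fromBlocks a b c d :=
    ⟨_, _, _, _, (fromBlocks_toBlocks B).symm⟩
  subst hB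
  have hS' : fromBlocks a b c d ∈ specialOrthogonalGroup (Fin N ⊕ Fin 1) ℝ := by
    rw [mem_specialOrthogonalGroup_iff_mul_transpose] at hS ⊢
    refine ⟨?_, by simpa using hS.2⟩
    have h1 := hS.1
    simp only [reindex_apply, transpose_submatrix, submatrix_mul_equiv] at h1
    have h2 := congrArg (reindex e.symm e.symm) h1
    simpa using h2
  obtain ⟨S', h1, h2⟩ := det_one_add_fromBlocks_mul hS'
  refine ⟨S', h1, fun T => ?_⟩
  have h3 : reindex e e (fromBlocks a b c d) (Fin.last N) (Fin.last N) = d 0 0 := by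
    have : e.symm (Fin.last N) = Sum.inr 0 := by
      rw [Equiv.symm_apply_eq]; rfl
    simp [this]
  rw [h3, ← h2 T, ← det_reindex_self e (1 + fromBlocks a b c d * fromBlocks T 0 0 1)]
  congr 1
  simp [extendLast, submatrix_add, ← he]

theorem one_sub_two_smul_vecMulVec {w : m → ℝ} (hw : w ⬝ᵥ w = 1) :
    (1 - (2 : ℝ) • vecMulVec w w) * (1 - (2 : ℝ) • vecMulVec w w)ᵀ = 1 ∧
      (1 - (2 : ℝ) • vecMulVec w w).det = -1 := by
  constructor
  · have h : vecMulVec w w * vecMulVec w w = vecMulVec w w := by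
      rw [vecMulVec_mul_vecMulVec, hw, one_smul]
    rw [transpose_sub, transpose_one, transpose_smul, transpose_vecMulVec]
    simp only [Matrix.sub_mul, Matrix.mul_sub, Matrix.smul_mul, Matrix.mul_smul, Matrix.one_mul,
      Matrix.mul_one, h]
    module
  · have : (1 - (2 : ℝ) • vecMulVec w w) =
        1 + replicateCol Unit (-(2 : ℝ) • w) * replicateRow Unit w := by
      rw [← vecMulVec_eq, smul_vecMulVec, neg_smul, sub_eq_add_neg]
    rw [this, det_one_add_replicateCol_mul_replicateRow, dotProduct_smul, hw]
    norm_num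

/-- Reflections in two unit vectors at angle θ/2 compose to a rotation by θ, so membership in the
group is inherited from reflections. Only the action on column i is recorded, as the moment
recursion uses nothing else. -/
theorem exists_planeRotation {i j : m} (hij : i ≠ j) (θ : ℝ) :
    ∃ R ∈ specialOrthogonalGroup m ℝ, ∀ S : Matrix m m ℝ,
      (R * S) i i = Real.cos θ * S i i - Real.sin θ * S j i ∧
      (R * S) j i = Real.sin θ * S i i + Real.cos θ * S j i := by
  obtain ⟨u, hu⟩ : ∃ u : m → ℝ, u = Pi.single i 1 := ⟨_, rfl⟩
  obtain ⟨w, hw⟩ : ∃ w : m → ℝ,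
    w = Real.cos (θ / 2) • Pi.single i 1 + Real.sin (θ / 2) • Pi.single j 1 := ⟨_, rfl⟩
  have hww : w ⬝ᵥ w = 1 := by
    simp [hw, hij, hij.symm, ← sq]
  have huu : u ⬝ᵥ u = 1 := by simp [hu]
  obtain ⟨h1, h2⟩ := one_sub_two_smul_vecMulVec hww
  obtain ⟨h3, h4⟩ := one_sub_two_smul_vecMulVec huu
  have hc : Real.cos θ = 2 * Real.cos (θ / 2) ^ 2 - 1 := by
    rw [← Real.cos_two_mul]; ring_nf
  have hs : Real.sin θ = 2 * Real.sin (θ / 2) * Real.cos (θ / 2) := by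
    rw [← Real.sin_two_mul]; ring_nf
  have hsc := Real.sin_sq_add_cos_sq (θ / 2)
  refine ⟨(1 - (2 : ℝ) • vecMulVec w w) * (1 - (2 : ℝ) • vecMulVec u u), ?_, fun S => ?_⟩
  · rw [mem_specialOrthogonalGroup_iff_mul_transpose]
    refine ⟨?_, by rw [det_mul, h2, h4]; norm_num⟩
    rw [transpose_mul, Matrix.mul_assoc, ← Matrix.mul_assoc _ _ (_ᵀ), h3, Matrix.one_mul, h1]
  · have hH : ∀ (v : m → ℝ) (X : Matrix m m ℝ) (k : m),
        ((1 - (2 : ℝ) • vecMulVec v v) * X) k i = X k i - 2 * v k * (v ⬝ᵥ fun l => X l i) := by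
      intro v X k
      rw [Matrix.sub_mul, Matrix.smul_mul, Matrix.one_mul, vecMulVec_mul]
      simp [vecMulVec_apply, vecMul, mul_assoc]
    have hu' : ∀ k, ((1 - (2 : ℝ) • vecMulVec u u) * S) k i = S k i - 2 * u k * S i i := by
      intro k
      rw [hH]
      simp [hu]
    have hwd : ∀ f : m → ℝ, w ⬝ᵥ f = Real.cos (θ / 2) * f i + Real.sin (θ / 2) * f j := by
      intro f
      simp [hw, add_dotProduct]
    have hwi : w i = Real.cos (θ / 2) := by simp [hw, hij]
    have hwj : w j = Real.sin (θ / 2) := by simp [hw, hij.symm]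
    have hui : u i = 1 := by simp [hu]
    have huj : u j = 0 := by simp [hu, hij.symm]
    rw [Matrix.mul_assoc, hH w _ i, hH w _ j, hwd]
    simp only [hu', hwi, hwj, hui, huj, hc, hs]
    constructor
    · ring
    · linear_combination (S j i) * (-2 * hsc)

end Matrix

/-- The rotation group of `ℝ^N`. -/
abbrev RotationGroup (N : ℕ) : Type := Matrix.specialOrthogonalGroup (Fin N) ℝ

/-! ### The compact group SO(N), its invariant measure, and the factorisation in law. -/

namespace RotationGroup

open Matrix

variable {N : ℕ}

instance : SecondCountableTopology (Matrix (Fin N) (Fin N) ℝ) :=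
  inferInstanceAs (SecondCountableTopology (Fin N → Fin N → ℝ))

instance : T2Space (Matrix (Fin N) (Fin N) ℝ) :=
  inferInstanceAs (T2Space (Fin N → Fin N → ℝ))

theorem sum_sq_col (S : RotationGroup N) (j : Fin N) : ∑ i, S.1 i j ^ 2 = 1 := by
  have h := congrFun (congrFun (transpose_mul_self_of_mem S.2) j) j
  simpa [mul_apply, sq] using h

theorem abs_apply_le_one (S : RotationGroup N) (i j : Fin N) : |S.1 i j| ≤ 1 := by
  rw [← sq_le_one_iff_abs_le_one, ← sum_sq_col S j]
  exact Finset.single_le_sum (f := fun i => S.1 i j ^ 2) (fun i _ => sq_nonneg _)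
    (Finset.mem_univ i)

instance : CompactSpace (RotationGroup N) := by
  refine isCompact_iff_compactSpace.mp ?_
  have hK : IsCompact (Set.univ.pi fun _ : Fin N => Set.univ.pi fun _ : Fin N =>
      Set.Icc (-1 : ℝ) 1) :=
    isCompact_univ_pi fun _ => isCompact_univ_pi fun _ => isCompact_Icc
  refine IsCompact.of_isClosed_subset (X := Matrix (Fin N) (Fin N) ℝ) hK ?_ ?_
  · have : ((specialOrthogonalGroup (Fin N) ℝ : Submonoid _) : Set (Matrix (Fin N) (Fin N) ℝ)) =
        {A | A * Aᵀ = 1} ∩ {A | A.det = 1} := by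
      ext A
      exact mem_specialOrthogonalGroup_iff_mul_transpose
    rw [this]
    exact (isClosed_eq (by fun_prop) continuous_const).inter
      (isClosed_eq (by fun_prop) continuous_const)
  · intro A hA i _ j _
    exact abs_le.mp (abs_apply_le_one ⟨A, hA⟩ i j)

instance : SecondCountableTopology (RotationGroup N) :=
  TopologicalSpace.Subtype.secondCountableTopology
    ((specialOrthogonalGroup (Fin N) ℝ : Submonoid _) : Set (Matrix (Fin N) (Fin N) ℝ))

instance : IsTopologicalGroup (RotationGroup N) where
  continuous_inv := by
    refine continuous_induced_rng.mpr ?_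
    change Continuous fun S : RotationGroup N => (S : Matrix (Fin N) (Fin N) ℝ)ᵀ
    fun_prop

/-- The inclusion of `SO(N)` in `SO(N + 1)` as the stabiliser of the last basis vector. -/
noncomputable def extend (T : RotationGroup N) : RotationGroup (N + 1) :=
  ⟨extendLast N T, extendLast_mem T.2⟩

theorem continuous_extend : Continuous (extend (N := N)) := by
  refine continuous_induced_rng.mpr ?_
  change Continuous fun T : RotationGroup N => reindex finSumFinEquiv finSumFinEquiv
    (fromBlocks (T : Matrix (Fin N) (Fin N) ℝ) 0 0 (1 : Matrix (Fin 1) (Fin 1) ℝ))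
  refine Continuous.matrix_reindex ?_ _ _
  exact Continuous.matrix_fromBlocks (by fun_prop) (by fun_prop) (by fun_prop) (by fun_prop)

/-- The value `det (1 + S)` of the characteristic polynomial of `S` at `-1`, up to sign. -/
noncomputable def detOneAdd (S : RotationGroup N) : ℝ := (1 + S.1).det

theorem continuous_detOneAdd : Continuous (detOneAdd (N := N)) := by
  unfold detOneAdd
  fun_prop

theorem continuous_apply (i j : Fin N) : Continuous fun S : RotationGroup N => S.1 i j :=
  continuous_subtype_val.matrix_elem i j

theorem exists_detOneAdd_mul_extend (S : RotationGroup (N + 1)) :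
    ∃ S' : RotationGroup N, ∀ T : RotationGroup N,
      detOneAdd (S * extend T) = (1 + S.1 (Fin.last N) (Fin.last N)) * detOneAdd (S' * T) := by
  obtain ⟨S', h, h'⟩ := det_one_add_mul_extendLast S.2
  exact ⟨⟨S', h⟩, fun T => h' T⟩

variable [MeasurableSpace (RotationGroup N)] [BorelSpace (RotationGroup N)]

/-- Averaging f(x⁻¹y) over both variables shows that inversion preserves μ; conjugating left
translation by inversion then gives right translation. -/
theorem map_mul_right_eq (μ : Measure (RotationGroup N)) [μ.IsMulLeftInvariant]
    [IsProbabilityMeasure μ] (g : RotationGroup N) : μ.map (· * g) = μ := by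
  have key : ∀ f : RotationGroup N → ENNReal, Measurable f →
      ∫⁻ x, f x ∂(μ.map (fun x => x⁻¹)) = ∫⁻ x, f x ∂μ := by
    intro f hf
    calc ∫⁻ x, f x ∂(μ.map (fun x => x⁻¹))
        = ∫⁻ x, f x⁻¹ ∂μ := lintegral_map hf measurable_inv
      _ = ∫⁻ _ : RotationGroup N, ∫⁻ x, f x⁻¹ ∂μ ∂μ := by simp
      _ = ∫⁻ y, ∫⁻ x, f (x⁻¹ * y) ∂μ ∂μ := by
        refine lintegral_congr fun y => ?_
        rw [← lintegral_mul_left_eq_self (fun x => f (x⁻¹ * y)) y]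
        simp
      _ = ∫⁻ x, ∫⁻ y, f (x⁻¹ * y) ∂μ ∂μ :=
        lintegral_lintegral_swap (hf.comp
          ((measurable_inv.comp measurable_snd).mul measurable_fst)).aemeasurable
      _ = ∫⁻ _ : RotationGroup N, ∫⁻ x, f x ∂μ ∂μ := by
        refine lintegral_congr fun x => lintegral_mul_left_eq_self _ _
      _ = ∫⁻ x, f x ∂μ := by simp
  refine Measure.ext_of_lintegral _ fun f hf => ?_
  rw [lintegral_map hf (by fun_prop), ← key _ (by fun_prop), lintegral_map (by fun_prop)
    measurable_inv, ← key f hf, lintegral_map hf measurable_inv,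
    ← lintegral_mul_left_eq_self (fun x => f x⁻¹) g⁻¹]
  simp

/-- Average over right translates by the embedded SO(N). For each fixed S, left invariance of ν
absorbs S', so S' need not depend measurably on S. -/
theorem map_detOneAdd_succ [MeasurableSpace (RotationGroup (N + 1))]
    [BorelSpace (RotationGroup (N + 1))] (μ : Measure (RotationGroup (N + 1)))
    [μ.IsMulLeftInvariant] [IsProbabilityMeasure μ]
    (ν : Measure (RotationGroup N)) [ν.IsMulLeftInvariant] [IsProbabilityMeasure ν] :
    μ.map detOneAdd = (μ.map fun S => 1 + S.1 (Fin.last N) (Fin.last N)).mconv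
      (ν.map detOneAdd) := by
  have hm := continuous_extend (N := N) |>.measurable
  have hd := continuous_detOneAdd (N := N) |>.measurable
  have hd' := continuous_detOneAdd (N := N + 1) |>.measurable
  have he : Measurable fun S : RotationGroup (N + 1) => 1 + S.1 (Fin.last N) (Fin.last N) :=
    (continuous_const.add (continuous_apply _ _)).measurable
  have := Measure.isProbabilityMeasure_map (μ := ν) hd.aemeasurable
  refine Measure.ext_of_lintegral _ fun f hf => ?_
  rw [Measure.lintegral_mconv hf, lintegral_map hf hd', lintegral_map _ he]
  · calc ∫⁻ S, f (detOneAdd S) ∂μ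
        = ∫⁻ _ : RotationGroup N, ∫⁻ S, f (detOneAdd S) ∂μ ∂ν := by simp
      _ = ∫⁻ T, ∫⁻ S, f (detOneAdd (S * extend T)) ∂μ ∂ν := by
        refine lintegral_congr fun T => ?_
        conv_lhs => rw [← map_mul_right_eq μ (extend T)]
        rw [lintegral_map (by fun_prop) (by fun_prop)]
      _ = ∫⁻ S, ∫⁻ T, f (detOneAdd (S * extend T)) ∂ν ∂μ :=
        lintegral_lintegral_swap ((hf.comp hd').comp
          (measurable_snd.mul (hm.comp measurable_fst))).aemeasurable
      _ = ∫⁻ S, ∫⁻ y, f ((1 + S.1 (Fin.last N) (Fin.last N)) * y) ∂(ν.map detOneAdd) ∂μ := by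
        refine lintegral_congr fun S => ?_
        rw [lintegral_map (by fun_prop) hd]
        obtain ⟨S', h⟩ := exists_detOneAdd_mul_extend S
        simp_rw [h]
        exact lintegral_mul_left_eq_self
          (fun T => f ((1 + S.1 (Fin.last N) (Fin.last N)) * detOneAdd T)) S'
  · exact Measurable.lintegral_prod_right' (f := fun p : ℝ × ℝ => f (p.1 * p.2)) (by fun_prop)

end RotationGroup

/-! ### Bounded laws are determined by their moments. -/

theorem integrable_pow_of_ae_abs_le {ρ : Measure ℝ} [IsFiniteMeasure ρ] {R : ℝ}
    (h : ∀ᵐ x ∂ρ, |x| ≤ R) (p : ℕ) : Integrable (fun x => x ^ p) ρ := by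
  refine Integrable.of_bound (by fun_prop) (R ^ p) ?_
  filter_upwards [h] with x hx
  rw [norm_pow]
  exact pow_le_pow_left₀ (norm_nonneg _) hx p

/-- Weierstrass approximation on [-R, R] passes from polynomials to bounded continuous test
functions. -/
theorem MeasureTheory.Measure.ext_of_forall_integral_pow_eq {ρ σ : Measure ℝ}
    [IsProbabilityMeasure ρ] [IsProbabilityMeasure σ] {R : ℝ}
    (hρ : ∀ᵐ x ∂ρ, |x| ≤ R) (hσ : ∀ᵐ x ∂σ, |x| ≤ R)
    (h : ∀ p : ℕ, ∫ x, x ^ p ∂ρ = ∫ x, x ^ p ∂σ) : ρ = σ := by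
  have hpoly : ∀ q : Polynomial ℝ, ∫ x, q.eval x ∂ρ = ∫ x, q.eval x ∂σ := by
    intro q
    simp_rw [Polynomial.eval_eq_sum_range]
    rw [integral_finsetSum _ fun i _ => (integrable_pow_of_ae_abs_le hρ i).const_mul _,
      integral_finsetSum _ fun i _ => (integrable_pow_of_ae_abs_le hσ i).const_mul _]
    simp_rw [integral_const_mul, h]
  have hpint : ∀ (τ : Measure ℝ) [IsProbabilityMeasure τ], (∀ᵐ x ∂τ, |x| ≤ R) →
      ∀ q : Polynomial ℝ, Integrable (fun x => q.eval x) τ := by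
    intro τ _ hτ q
    simp_rw [Polynomial.eval_eq_sum_range]
    exact integrable_finsetSum _ fun i _ => (integrable_pow_of_ae_abs_le hτ i).const_mul _
  refine ext_of_forall_integral_eq_of_IsFiniteMeasure fun f => ?_
  have hclose : ∀ (τ : Measure ℝ) [IsProbabilityMeasure τ], (∀ᵐ x ∂τ, |x| ≤ R) →
      ∀ ε (q : Polynomial ℝ), (∀ x ∈ Set.Icc (-R) R, |q.eval x - f x| < ε) →
      |∫ x, q.eval x ∂τ - ∫ x, f x ∂τ| ≤ ε := by
    intro τ _ hτ ε q hq
    rw [← integral_sub (hpint τ hτ q) (f.integrable τ)]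
    have := norm_integral_le_of_norm_le_const (μ := τ) (f := fun x => q.eval x - f x) (C := ε) (by
      filter_upwards [hτ] with x hx
      exact (hq x (abs_le.mp hx)).le)
    simpa using this
  refine eq_of_forall_dist_le fun ε hε => ?_
  obtain ⟨q, hq⟩ := exists_polynomial_near_of_continuousOn (-R) R f f.continuous.continuousOn
    (ε / 2) (by positivity)
  have h1 := hclose ρ hρ _ q hq
  have h2 := hclose σ hσ _ q hq
  rw [hpoly q] at h1
  rw [Real.dist_eq]
  rw [abs_le] at *
  constructor <;> linarith [h1.1, h1.2, h2.1, h2.2]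

/-- The moment relations of the law of one coordinate of a uniform point on the unit sphere in
dimension `c`. -/
structure HasSphereMoments (c : ℝ) (ρ : Measure ℝ) : Prop where
  isProbabilityMeasure : IsProbabilityMeasure ρ
  ae_abs_le : ∀ᵐ x ∂ρ, |x| ≤ 1
  integral_id : ∫ x, x ∂ρ = 0
  integral_pow_add_two : ∀ p : ℕ, (c + p) * ∫ x, x ^ (p + 2) ∂ρ = (p + 1) * ∫ x, x ^ p ∂ρ

theorem HasSphereMoments.eq {c : ℝ} (hc : 0 < c) {ρ σ : Measure ℝ} (hρ : HasSphereMoments c ρ)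
    (hσ : HasSphereMoments c σ) : ρ = σ := by
  have := hρ.isProbabilityMeasure
  have := hσ.isProbabilityMeasure
  refine Measure.ext_of_forall_integral_pow_eq hρ.ae_abs_le hσ.ae_abs_le fun p => ?_
  induction p using Nat.twoStepInduction with
  | zero => simp
  | one => simp [hρ.integral_id, hσ.integral_id]
  | more p h _ =>
    have hp : c + p ≠ 0 := by positivity
    apply mul_left_cancel₀ hp
    rw [hρ.integral_pow_add_two, hσ.integral_pow_add_two, h]

/-! ### Moments of a diagonal entry of a Haar rotation. -/

namespace RotationGroup

variable {N : ℕ} [MeasurableSpace (RotationGroup N)] [BorelSpace (RotationGroup N)]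
  (μ : Measure (RotationGroup N)) [μ.IsMulLeftInvariant] [IsProbabilityMeasure μ]

/-- Rotating the (i, j) plane by θ leaves the mean of x^p y unchanged, where x and y are entries i
and j of column i. The identity says that its θ-derivative vanishes at 0. -/
theorem integral_apply_pow_succ {i j : Fin N} (hij : i ≠ j) (p : ℕ) :
    ∫ S, S.1 i i ^ (p + 1) ∂μ = p * ∫ S, S.1 i i ^ (p - 1) * S.1 j i ^ 2 ∂μ := by
  set x : RotationGroup N → ℝ := fun S => S.1 i i with hx
  set y : RotationGroup N → ℝ := fun S => S.1 j i with hy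
  have hxm : Continuous x := continuous_apply i i
  have hym : Continuous y := continuous_apply j i
  have hx1 : ∀ S, |x S| ≤ 1 := fun S => abs_apply_le_one S i i
  have hy1 : ∀ S, |y S| ≤ 1 := fun S => abs_apply_le_one S j i
  set F : ℝ → RotationGroup N → ℝ := fun θ S =>
    (Real.cos θ * x S - Real.sin θ * y S) ^ p * (Real.sin θ * x S + Real.cos θ * y S) with hF
  set F' : ℝ → RotationGroup N → ℝ := fun θ S =>
    (Real.cos θ * x S - Real.sin θ * y S) ^ (p + 1) -
    p * ((Real.cos θ * x S - Real.sin θ * y S) ^ (p - 1) *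
      (Real.sin θ * x S + Real.cos θ * y S) ^ 2) with hF'
  have hconst : ∀ θ, ∫ S, F θ S ∂μ = ∫ S, F 0 S ∂μ := by
    intro θ
    obtain ⟨R, hR, h⟩ := Matrix.exists_planeRotation hij θ
    rw [← integral_mul_left_eq_self (F 0) (⟨R, hR⟩ : RotationGroup N)]
    refine integral_congr_ae (.of_forall fun S => ?_)
    simp only [hF, Real.cos_zero, Real.sin_zero, one_mul, zero_mul, sub_zero, zero_add, hx, hy]
    rw [← (h S.1).1, ← (h S.1).2]
    rfl
  have hu : ∀ θ S, |Real.cos θ * x S - Real.sin θ * y S| ≤ 2 := by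
    intro θ S
    refine (abs_sub _ _).trans ?_
    rw [abs_mul, abs_mul]
    nlinarith [mul_le_one₀ (Real.abs_cos_le_one θ) (abs_nonneg _) (hx1 S),
      mul_le_one₀ (Real.abs_sin_le_one θ) (abs_nonneg _) (hy1 S)]
  have hv : ∀ θ S, |Real.sin θ * x S + Real.cos θ * y S| ≤ 2 := by
    intro θ S
    refine (abs_add_le _ _).trans ?_
    rw [abs_mul, abs_mul]
    nlinarith [mul_le_one₀ (Real.abs_sin_le_one θ) (abs_nonneg _) (hx1 S),
      mul_le_one₀ (Real.abs_cos_le_one θ) (abs_nonneg _) (hy1 S)]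
  have hFc : ∀ θ, Continuous (F θ) := fun θ => by fun_prop
  have hF'c : ∀ θ, Continuous (F' θ) := fun θ => by fun_prop
  have hint : ∀ f : RotationGroup N → ℝ, Continuous f → Integrable f μ := fun f hf =>
    hf.integrable_of_hasCompactSupport (HasCompactSupport.of_compactSpace f)
  have hder := (hasDerivAt_integral_of_dominated_loc_of_deriv_le (μ := μ) (F := F) (F' := F')
    (x₀ := 0) (s := Set.univ) (bound := fun _ => 2 ^ (p + 1) + p * (2 ^ (p - 1) * 2 ^ 2))
    Filter.univ_mem (.of_forall fun θ => (hFc θ).aestronglyMeasurable) (hint _ (hFc 0))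
    (hF'c 0).aestronglyMeasurable ?_ (integrable_const _) ?_).2
  · simp_rw [hconst] at hder
    have h0 := hder.unique (hasDerivAt_const 0 _)
    simp only [hF', Real.cos_zero, Real.sin_zero, one_mul, zero_mul, sub_zero, zero_add] at h0
    rw [integral_sub (hint _ (by fun_prop)) (hint _ (by fun_prop)), integral_const_mul,
      sub_eq_zero] at h0
    exact h0
  · refine .of_forall fun S θ _ => ?_
    refine (norm_sub_le _ _).trans (add_le_add ?_ ?_)
    · rw [norm_pow]
      exact pow_le_pow_left₀ (norm_nonneg _) (hu θ S) _
    · rw [norm_mul, norm_mul, norm_pow, norm_pow, Real.norm_natCast]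
      gcongr
      · exact hu θ S
      · exact hv θ S
  · refine .of_forall fun S θ _ => ?_
    have hc := (Real.hasDerivAt_cos θ).mul_const (x S)
    have hs := (Real.hasDerivAt_sin θ).mul_const (y S)
    have hc' := (Real.hasDerivAt_cos θ).mul_const (y S)
    have hs' := (Real.hasDerivAt_sin θ).mul_const (x S)
    refine (((hc.sub hs).pow p).mul (hs'.add hc')).congr_deriv ?_
    simp only [hF', Pi.sub_apply, Pi.add_apply, Pi.pow_apply]
    ring

/-- Summing the previous identity over j ≠ i and using that column i has norm one replaces the
squares of the other entries by 1 - x². The case p = 0 of `key` gives mean zero, where the truncated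
p - 1 is harmless because its factor p is 0; the other cases give the recursion. -/
theorem hasSphereMoments_map_apply (hN : 2 ≤ N) (i : Fin N) :
    HasSphereMoments N (μ.map fun S => S.1 i i) := by
  have hc : Continuous fun S : RotationGroup N => S.1 i i := continuous_apply i i
  have hm := hc.measurable
  have hint : ∀ f : RotationGroup N → ℝ, Continuous f → Integrable f μ := fun f hf =>
    hf.integrable_of_hasCompactSupport (HasCompactSupport.of_compactSpace f)
  have key : ∀ p : ℕ, (N - 1 : ℝ) * ∫ S, S.1 i i ^ (p + 1) ∂μ =
      p * (∫ S, S.1 i i ^ (p - 1) ∂μ - ∫ S, S.1 i i ^ (p - 1) * S.1 i i ^ 2 ∂μ) := by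
    intro p
    have h1 : ∑ j ∈ Finset.univ.erase i, ∫ S, S.1 i i ^ (p + 1) ∂μ =
        ∑ j ∈ Finset.univ.erase i, p * ∫ S, S.1 i i ^ (p - 1) * S.1 j i ^ 2 ∂μ :=
      Finset.sum_congr rfl fun j hj =>
        integral_apply_pow_succ μ (Finset.ne_of_mem_erase hj).symm p
    rw [Finset.sum_const, Finset.card_erase_of_mem (Finset.mem_univ i), Finset.card_fin,
      nsmul_eq_mul, Nat.cast_sub (by omega), Nat.cast_one, ← Finset.mul_sum] at h1
    have hcont : ∀ j, Continuous fun S : RotationGroup N => S.1 i i ^ (p - 1) * S.1 j i ^ 2 :=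
      fun j => (hc.pow _).mul ((continuous_apply j i).pow 2)
    have h2 : ∫ S, ∑ j ∈ Finset.univ.erase i, S.1 i i ^ (p - 1) * S.1 j i ^ 2 ∂μ =
        ∑ j ∈ Finset.univ.erase i, ∫ S, S.1 i i ^ (p - 1) * S.1 j i ^ 2 ∂μ :=
      integral_finsetSum _ fun j _ => hint _ (hcont j)
    rw [h1, ← h2, ← integral_sub (hint (fun S => S.1 i i ^ (p - 1)) (hc.pow _))
      (hint _ (hcont i))]
    congr 1
    refine integral_congr_ae (.of_forall fun S => ?_)
    have h3 := sum_sq_col S i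
    rw [← Finset.add_sum_erase _ _ (Finset.mem_univ i)] at h3
    simp only [← Finset.mul_sum]
    linear_combination S.1 i i ^ (p - 1) * h3
  have hN1 : (N - 1 : ℝ) ≠ 0 := by
    have : (2 : ℝ) ≤ N := by exact_mod_cast hN
    linarith
  refine ⟨Measure.isProbabilityMeasure_map hm.aemeasurable, ?_, ?_, fun p => ?_⟩
  · rw [ae_map_iff hm.aemeasurable (measurableSet_le (by fun_prop) (by fun_prop))]
    exact .of_forall fun S => abs_apply_le_one S i i
  · rw [integral_map hm.aemeasurable (by fun_prop)]
    have := key 0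
    simpa [hN1] using this
  · rw [integral_map hm.aemeasurable (by fun_prop), integral_map hm.aemeasurable (by fun_prop)]
    have := key (p + 1)
    simp only [Nat.add_sub_cancel, ← pow_add] at this
    push_cast at this
    linear_combination this

end RotationGroup

/-! ### Beta integrals and the two Beta models of a sphere coordinate. -/

section Beta

variable {E : Type*} [NormedAddCommGroup E] [NormedSpace ℝ E] {a b : ℝ}

theorem betaPDF_toReal_smul (ha : 0 < a) (hb : 0 < b) (g : ℝ → E) :
    (fun x => (betaPDF a b x).toReal • g x) = (Set.Ioo (0 : ℝ) 1).indicator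
      fun x => (beta a b)⁻¹ • ((x ^ (a - 1) * (1 - x) ^ (b - 1)) • g x) := by
  ext x
  by_cases hx : x ∈ Set.Ioo (0 : ℝ) 1
  · have h := betaPDFReal_pos hx.1 hx.2 ha hb
    rw [Set.indicator_of_mem hx, betaPDF, ENNReal.toReal_ofReal h.le, betaPDFReal, if_pos (Set.mem_Ioo.mp hx),
      smul_smul, one_div, mul_assoc]
  · rw [Set.indicator_of_notMem hx, betaPDF, betaPDFReal, if_neg (fun h => hx (Set.mem_Ioo.mpr h))]
    simp

theorem measurable_betaPDF : Measurable (betaPDF a b) :=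
  (measurable_betaPDFReal a b).ennreal_ofReal

theorem integral_betaMeasure (ha : 0 < a) (hb : 0 < b) (g : ℝ → E) :
    ∫ x, g x ∂(betaMeasure a b) =
      (beta a b)⁻¹ • ∫ x in Set.Ioo (0 : ℝ) 1, (x ^ (a - 1) * (1 - x) ^ (b - 1)) • g x := by
  rw [betaMeasure, integral_withDensity_eq_integral_toReal_smul measurable_betaPDF
    (.of_forall fun x => ENNReal.ofReal_lt_top), betaPDF_toReal_smul ha hb,
    integral_indicator measurableSet_Ioo, integral_smul]

theorem integrable_betaMeasure_iff (ha : 0 < a) (hb : 0 < b) (g : ℝ → E) :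
    Integrable g (betaMeasure a b) ↔
      IntegrableOn (fun x => (x ^ (a - 1) * (1 - x) ^ (b - 1)) • g x) (Set.Ioo (0 : ℝ) 1) := by
  rw [betaMeasure, integrable_withDensity_iff_integrable_smul' measurable_betaPDF
    (.of_forall fun x => ENNReal.ofReal_lt_top), betaPDF_toReal_smul ha hb,
    integrable_indicator_iff measurableSet_Ioo, IntegrableOn,
    integrable_fun_smul_iff (inv_ne_zero (beta_pos ha hb).ne')]
  rfl

theorem ae_betaMeasure_mem_Ioo : ∀ᵐ x ∂(betaMeasure a b), x ∈ Set.Ioo (0 : ℝ) 1 := by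
  rw [betaMeasure, ae_withDensity_iff measurable_betaPDF]
  refine .of_forall fun x hx => ?_
  by_contra h
  apply hx
  rw [betaPDF, betaPDFReal, if_neg (fun h' => h (Set.mem_Ioo.mpr h')), ENNReal.ofReal_zero]

theorem cpow_betaMeasure (ha : 0 < a) (hb : 0 < b) {t : ℂ} (ht : -a < t.re) :
    Integrable (fun x : ℝ => (x : ℂ) ^ t) (betaMeasure a b) ∧
    ∫ x : ℝ, (x : ℂ) ^ t ∂(betaMeasure a b) =
      (Complex.Gamma (a + t) * Complex.Gamma (a + b)) /
        (Complex.Gamma a * Complex.Gamma (a + b + t)) := by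
  have hat : 0 < (a + t : ℂ).re := by simp; linarith
  have hb' : 0 < (b : ℂ).re := by simpa
  have hcongr : Set.EqOn (fun x : ℝ => (x ^ (a - 1) * (1 - x) ^ (b - 1)) • (x : ℂ) ^ t)
      (fun x : ℝ => (x : ℂ) ^ ((a + t : ℂ) - 1) * (1 - (x : ℂ)) ^ ((b : ℂ) - 1))
      (Set.Ioo 0 1) := by
    intro x hx
    have hx0 : (x : ℂ) ≠ 0 := by exact_mod_cast hx.1.ne'
    simp only [Complex.real_smul, Complex.ofReal_mul]
    rw [Complex.ofReal_cpow hx.1.le, Complex.ofReal_cpow (by linarith [hx.2]),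
      show (a + t : ℂ) - 1 = (a - 1 : ℂ) + t by ring, Complex.cpow_add _ _ hx0]
    push_cast
    ring
  constructor
  · rw [integrable_betaMeasure_iff ha hb, integrableOn_congr_fun hcongr measurableSet_Ioo,
      ← integrableOn_Ioc_iff_integrableOn_Ioo,
      ← intervalIntegrable_iff_integrableOn_Ioc_of_le zero_le_one]
    exact Complex.betaIntegral_convergent hat hb'
  · have hB : ∫ x in Set.Ioo (0 : ℝ) 1,
        (x : ℂ) ^ ((a + t : ℂ) - 1) * (1 - (x : ℂ)) ^ ((b : ℂ) - 1) =
        Complex.betaIntegral (a + t) b := by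
      rw [Complex.betaIntegral, intervalIntegral.integral_of_le zero_le_one,
        integral_Ioc_eq_integral_Ioo]
    rw [integral_betaMeasure ha hb, setIntegral_congr_fun measurableSet_Ioo hcongr, hB,
      Complex.betaIntegral_eq_Gamma_mul_div _ _ hat hb', beta, Complex.real_smul]
    have h1 := Complex.Gamma_ne_zero_of_re_pos hb'
    push_cast [← Complex.Gamma_ofReal]
    rw [show (a + t + b : ℂ) = a + b + t by ring]
    have h2 : Complex.Gamma (a + b + t) ≠ 0 := Complex.Gamma_ne_zero_of_re_pos (by
      simp at hat ⊢; linarith)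
    have h3 : Complex.Gamma a ≠ 0 := Complex.Gamma_ne_zero_of_re_pos (by simpa)
    field_simp

/-- The q-th power of √x is x^(q/2), so raising q by 2 shifts one Gamma argument by 1 in the
numerator and one in the denominator. -/
theorem integral_sqrt_pow_betaMeasure (hb : 0 < b) (p : ℕ) :
    (1 + 2 * b + p) * ∫ x, √x ^ (p + 2) ∂(betaMeasure (1 / 2) b) =
      (p + 1) * ∫ x, √x ^ p ∂(betaMeasure (1 / 2) b) := by
  have key : ∀ q : ℕ, ((∫ x, √x ^ q ∂(betaMeasure (1 / 2) b) : ℝ) : ℂ) =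
      (Complex.Gamma ((1 / 2 : ℝ) + (q / 2 : ℂ)) * Complex.Gamma ((1 / 2 : ℝ) + b)) /
        (Complex.Gamma (1 / 2 : ℝ) * Complex.Gamma ((1 / 2 : ℝ) + b + (q / 2 : ℂ))) := by
    intro q
    have hq : (q / 2 : ℂ) = ((q / 2 : ℝ) : ℂ) := by push_cast; rfl
    rw [← (cpow_betaMeasure (a := 1 / 2) (by norm_num) hb (t := q / 2) ?_).2,
      ← integral_complex_ofReal]
    · refine integral_congr_ae ?_
      filter_upwards [ae_betaMeasure_mem_Ioo] with x hx
      rw [hq, ← Complex.ofReal_cpow hx.1.le, Real.sqrt_eq_rpow, ← Real.rpow_mul_natCast hx.1.le]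
      ring_nf
    · rw [hq, Complex.ofReal_re]
      have : (0 : ℝ) ≤ q / 2 := by positivity
      linarith
  have h := key (p + 2)
  rw [show (1 / 2 : ℝ) + (((p + 2 : ℕ) : ℂ) / 2) = ((1 / 2 : ℝ) + (p / 2 : ℂ)) + 1 by
      push_cast; ring,
    show (1 / 2 : ℝ) + (b : ℂ) + (((p + 2 : ℕ) : ℂ) / 2) = ((1 / 2 : ℝ) + b + (p / 2 : ℂ)) + 1 by
      push_cast; ring] at h
  have hne1 : ((1 / 2 : ℝ) + (p / 2 : ℂ)) ≠ 0 := by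
    have : (0 : ℝ) < 1 / 2 + p / 2 := by positivity
    rw [show ((1 / 2 : ℝ) + (p / 2 : ℂ)) = ((1 / 2 + p / 2 : ℝ) : ℂ) by push_cast; rfl]
    exact_mod_cast this.ne'
  have hre : (0 : ℝ) < 1 / 2 + b + p / 2 := by positivity
  have hre' : (((1 / 2 : ℝ) : ℂ) + b + (p / 2 : ℂ)) = ((1 / 2 + b + p / 2 : ℝ) : ℂ) := by
    push_cast; rfl
  have hne2 : (((1 / 2 : ℝ) : ℂ) + b + (p / 2 : ℂ)) ≠ 0 := by
    rw [hre']; exact_mod_cast hre.ne'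
  rw [Complex.Gamma_add_one _ hne1, Complex.Gamma_add_one _ hne2] at h
  have hG : Complex.Gamma (((1 / 2 : ℝ) : ℂ) + b + (p / 2 : ℂ)) ≠ 0 :=
    Complex.Gamma_ne_zero_of_re_pos (by rw [hre', Complex.ofReal_re]; exact hre)
  have hG' : Complex.Gamma ((1 / 2 : ℝ) : ℂ) ≠ 0 :=
    Complex.Gamma_ne_zero_of_re_pos (by rw [Complex.ofReal_re]; norm_num)
  have : ((((1 + 2 * b + p) * ∫ x, √x ^ (p + 2) ∂(betaMeasure (1 / 2) b) : ℝ)) : ℂ) =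
      (((p + 1) * ∫ x, √x ^ p ∂(betaMeasure (1 / 2) b) : ℝ) : ℂ) := by
    rw [Complex.ofReal_mul, Complex.ofReal_mul, h, key p]
    rw [mul_div_assoc', mul_div_assoc', div_eq_div_iff (by positivity) (by positivity)]
    push_cast
    ring
  exact_mod_cast this

/-- Up to the Beta weight, the integrand is the derivative of (2x - 1)^q (x(1 - x))^a, which
vanishes at 0 and 1. -/
theorem integral_deriv_mul_betaMeasure (ha : 0 < a) (q : ℕ) :
    ∫ x, (2 * q * (2 * x - 1) ^ (q - 1) * (x * (1 - x)) - a * (2 * x - 1) ^ (q + 1))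
      ∂(betaMeasure a a) = 0 := by
  have := isProbabilityMeasureBeta ha ha
  set G : ℝ → ℝ := fun x =>
    2 * q * (2 * x - 1) ^ (q - 1) * (x * (1 - x)) - a * (2 * x - 1) ^ (q + 1) with hG
  have hGi : Integrable G (betaMeasure a a) := by
    refine Integrable.of_bound (by fun_prop) (2 * q + a) ?_
    filter_upwards [ae_betaMeasure_mem_Ioo] with x hx
    have hy : |2 * x - 1| ≤ 1 := by rw [abs_le]; constructor <;> linarith [hx.1, hx.2]
    refine (norm_sub_le _ _).trans (add_le_add ?_ ?_)
    · rw [norm_mul, norm_mul, norm_pow, Real.norm_of_nonneg (by positivity : (0 : ℝ) ≤ 2 * q)]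
      have h1 : ‖2 * x - 1‖ ^ (q - 1) ≤ 1 := pow_le_one₀ (norm_nonneg _) hy
      have h2 : ‖x * (1 - x)‖ ≤ 1 := by
        rw [Real.norm_eq_abs, abs_le]
        constructor <;> nlinarith [hx.1, hx.2]
      calc 2 * (q : ℝ) * ‖2 * x - 1‖ ^ (q - 1) * ‖x * (1 - x)‖ ≤ 2 * q * 1 * 1 := by gcongr
        _ = 2 * q := by ring
    · rw [norm_mul, norm_pow, Real.norm_of_nonneg ha.le]
      exact mul_le_of_le_one_right ha.le (pow_le_one₀ (norm_nonneg _) hy)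
  rw [integrable_betaMeasure_iff ha ha, ← integrableOn_Ioc_iff_integrableOn_Ioo,
      ← intervalIntegrable_iff_integrableOn_Ioc_of_le zero_le_one] at hGi
  rw [integral_betaMeasure ha ha, ← integral_Ioc_eq_integral_Ioo,
    ← intervalIntegral.integral_of_le zero_le_one,
    intervalIntegral.integral_eq_sub_of_hasDerivAt_of_le zero_le_one
      (f := fun x => (2 * x - 1) ^ q * (x ^ a * (1 - x) ^ a)) ?_ ?_ hGi]
  · simp [Real.zero_rpow ha.ne']
  · have h1 : Continuous fun x : ℝ => x ^ a := Real.continuous_rpow_const ha.le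
    have h2 : Continuous fun x : ℝ => (1 - x) ^ a := h1.comp (continuous_const.sub continuous_id)
    exact Continuous.continuousOn (by fun_prop)
  · intro x hx
    have hx1 : 0 < 1 - x := by linarith [hx.2]
    have d1 : HasDerivAt (fun x : ℝ => 2 * x - 1) 2 x := by
      simpa using ((hasDerivAt_id x).const_mul 2).sub_const 1
    have d2 := Real.hasDerivAt_rpow_const (x := x) (p := a) (Or.inl hx.1.ne')
    have d3 := ((hasDerivAt_id x).const_sub 1).rpow_const (p := a) (Or.inl hx1.ne')
    refine ((d1.pow q).mul (d2.mul d3)).congr_deriv ?_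
    have e1 : x ^ a = x ^ (a - 1) * x := by
      rw [← Real.rpow_add_one hx.1.ne', sub_add_cancel]
    have e2 : (1 - x) ^ a = (1 - x) ^ (a - 1) * (1 - x) := by
      rw [← Real.rpow_add_one hx1.ne', sub_add_cancel]
    simp only [hG, Pi.pow_apply, Pi.mul_apply, id_eq, smul_eq_mul, e1, e2]
    ring

theorem hasSphereMoments_map_betaMeasure (ha : 0 < a) :
    HasSphereMoments (2 * a + 1) ((betaMeasure a a).map fun x => 2 * x - 1) := by
  have := isProbabilityMeasureBeta ha ha
  have hm : Measurable fun x : ℝ => 2 * x - 1 := by fun_prop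
  have hy : ∀ᵐ x ∂(betaMeasure a a), |2 * x - 1| ≤ 1 := by
    filter_upwards [ae_betaMeasure_mem_Ioo] with x hx
    rw [abs_le]
    constructor <;> linarith [hx.1, hx.2]
  have hi : ∀ p : ℕ, Integrable (fun x : ℝ => (2 * x - 1) ^ p) (betaMeasure a a) := by
    intro p
    refine Integrable.of_bound (by fun_prop) 1 ?_
    filter_upwards [hy] with x hx
    rw [norm_pow]
    exact pow_le_one₀ (norm_nonneg _) hx
  refine ⟨Measure.isProbabilityMeasure_map hm.aemeasurable, ?_, ?_, fun p => ?_⟩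
  · rwa [ae_map_iff hm.aemeasurable (measurableSet_le (by fun_prop) (by fun_prop))]
  · rw [integral_map hm.aemeasurable (by fun_prop)]
    have h := integral_deriv_mul_betaMeasure ha 0
    simp only [Nat.cast_zero, mul_zero, zero_mul, zero_sub, zero_add, pow_one] at h
    rw [integral_neg, integral_const_mul, neg_eq_zero] at h
    exact (mul_eq_zero.mp h).resolve_left ha.ne'
  · rw [integral_map hm.aemeasurable (by fun_prop), integral_map hm.aemeasurable (by fun_prop)]
    have h := integral_deriv_mul_betaMeasure ha (p + 1)
    -- Uses 4x(1 - x) = 1 - (2x - 1)².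
    have h2 : ∀ x : ℝ, 2 * ((p + 1 : ℕ) : ℝ) * (2 * x - 1) ^ (p + 1 - 1) * (x * (1 - x)) -
        a * (2 * x - 1) ^ (p + 1 + 1) = (p + 1) / 2 * (2 * x - 1) ^ p -
        (2 * a + 1 + p) / 2 * (2 * x - 1) ^ (p + 2) := by
      intro x
      rw [Nat.add_sub_cancel]
      push_cast
      ring
    simp_rw [h2] at h
    rw [integral_sub ((hi _).const_mul _) ((hi _).const_mul _), integral_const_mul,
      integral_const_mul] at h
    linear_combination -2 * h

end Beta

/-- Independence splits each moment into one of ε and one of √β. Since ε² = 1 almost surely, the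
recursion for √β carries over, and symmetry of ε supplies mean zero. -/
theorem hasSphereMoments_map_sign_mul_sqrt {Ω : Type*} [MeasurableSpace Ω] {P : Measure Ω}
    [IsProbabilityMeasure P] {ε β : Ω → ℝ} {b : ℝ} (hb : 0 < b) (hε : AEMeasurable ε P)
    (h1 : P {ω | ε ω = 1} = 1 / 2) (h2 : P {ω | ε ω = -1} = 1 / 2)
    (hβ : HasLaw β (betaMeasure (1 / 2) b) P) (hi : IndepFun ε β P) :
    HasSphereMoments (1 + 2 * b) (P.map fun ω => ε ω * √(β ω)) := by
  have hβm := hβ.aemeasurable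
  have hm : AEMeasurable (fun ω => ε ω * √(β ω)) P := by fun_prop
  have hρ : IsProbabilityMeasure (P.map ε) := Measure.isProbabilityMeasure_map hε
  have hρ1 : (P.map ε) {1} = 1 / 2 := by
    rw [Measure.map_apply_of_aemeasurable hε (measurableSet_singleton _), ← h1]; rfl
  have hρ2 : (P.map ε) {-1} = 1 / 2 := by
    rw [Measure.map_apply_of_aemeasurable hε (measurableSet_singleton _), ← h2]; rfl
  have hdisj : Disjoint ({1} : Set ℝ) {-1} := by
    rw [Set.disjoint_singleton]; norm_num
  have hρae : ∀ᵐ x ∂(P.map ε), x ∈ ({1} ∪ {-1} : Set ℝ) := by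
    have hu : (P.map ε) ({1} ∪ {-1}) = 1 := by
      rw [measure_union hdisj (measurableSet_singleton _), hρ1, hρ2, ENNReal.add_halves]
    rw [← prob_compl_eq_zero_iff (by measurability)] at hu
    exact hu
  have hεae : ∀ᵐ ω ∂P, ε ω = 1 ∨ ε ω = -1 := ae_of_ae_map hε hρae
  have hε0 : ∫ ω, ε ω ∂P = 0 := by
    have : ∫ x, x ∂(P.map ε) = 0 := by
      rw [← Measure.restrict_eq_self_of_ae_mem hρae, setIntegral_union hdisj
        (measurableSet_singleton _) (integrableOn_singleton (by simp))
        (integrableOn_singleton (by simp))]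
      simp [hρ1, hρ2]
    rwa [integral_map hε (by fun_prop)] at this
  have hβae : ∀ᵐ ω ∂P, β ω ∈ Set.Ioo (0 : ℝ) 1 := by
    have := ae_betaMeasure_mem_Ioo (a := 1 / 2) (b := b)
    rw [← hβ.map_eq] at this
    exact ae_of_ae_map hβm this
  have hmom : ∀ p : ℕ, ∫ x, x ^ p ∂(P.map fun ω => ε ω * √(β ω)) =
      (∫ ω, ε ω ^ p ∂P) * ∫ x, √x ^ p ∂(betaMeasure (1 / 2) b) := by
    intro p
    rw [integral_map hm (by fun_prop), ← hβ.map_eq, integral_map hβm (by fun_prop)]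
    simp_rw [mul_pow]
    exact (hi.comp (φ := fun x => x ^ p) (ψ := fun x => √x ^ p) (by fun_prop)
      (by fun_prop)).integral_fun_mul_eq_mul_integral
      (hε.pow_const p).aestronglyMeasurable (hβm.sqrt.pow_const p).aestronglyMeasurable
  refine ⟨Measure.isProbabilityMeasure_map hm, ?_, ?_, fun p => ?_⟩
  · rw [ae_map_iff hm (measurableSet_le (by fun_prop) (by fun_prop))]
    filter_upwards [hεae, hβae] with ω hω hω'
    have : |√(β ω)| ≤ 1 := by
      rw [abs_of_nonneg (Real.sqrt_nonneg _)]
      exact Real.sqrt_le_one.mpr hω'.2.le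
    rcases hω with h | h <;> simpa [h] using this
  · have := hmom 1
    simpa [hε0] using this
  · rw [hmom, hmom]
    have : ∫ ω, ε ω ^ (p + 2) ∂P = ∫ ω, ε ω ^ p ∂P := by
      refine integral_congr_ae ?_
      filter_upwards [hεae] with ω hω
      rcases hω with h | h <;> simp [h, pow_add]
    rw [this]
    linear_combination (∫ ω, ε ω ^ p ∂P) * integral_sqrt_pow_betaMeasure hb p

/-- The law of `1 + x`, where `x` is a coordinate of a uniform point of the unit sphere of
`ℝ^k`. -/
noncomputable def onePlusSphereLaw (k : ℕ) : Measure ℝ :=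
  (betaMeasure (((k : ℝ) - 1) / 2) (((k : ℝ) - 1) / 2)).map fun x => 2 * x

section OnePlusSphereLaw

variable {k : ℕ}

theorem half_sub_one_pos (hk : 2 ≤ k) : 0 < ((k : ℝ) - 1) / 2 := by
  have : (2 : ℝ) ≤ k := by exact_mod_cast hk
  linarith

theorem isProbabilityMeasure_onePlusSphereLaw (hk : 2 ≤ k) :
    IsProbabilityMeasure (onePlusSphereLaw k) := by
  have := isProbabilityMeasureBeta (half_sub_one_pos hk) (half_sub_one_pos hk)
  exact Measure.isProbabilityMeasure_map (by fun_prop)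

theorem HasSphereMoments.map_one_add (hk : 2 ≤ k) {ρ : Measure ℝ} (h : HasSphereMoments k ρ) :
    ρ.map (fun x => 1 + x) = onePlusSphereLaw k := by
  have h' := hasSphereMoments_map_betaMeasure (half_sub_one_pos hk)
  rw [mul_div_cancel₀ _ two_ne_zero, sub_add_cancel] at h'
  rw [h.eq (by positivity) h', Measure.map_map (by fun_prop) (by fun_prop), onePlusSphereLaw]
  congr 1
  ext x
  simp

theorem ae_onePlusSphereLaw_mem_Icc : ∀ᵐ x ∂(onePlusSphereLaw k), x ∈ Set.Icc (0 : ℝ) 2 := by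
  refine (ae_map_iff (by fun_prop) measurableSet_Icc).mpr ?_
  filter_upwards [ae_betaMeasure_mem_Ioo] with x hx
  constructor <;> linarith [hx.1, hx.2]

/-- The Beta parameter (k - 1)/2 is at least 1/2, with equality at k = 2, hence the range of t. -/
theorem cpow_onePlusSphereLaw (hk : 2 ≤ k) {t : ℂ} (ht : -1 / 2 < t.re) :
    Integrable (fun x : ℝ => (x : ℂ) ^ t) (onePlusSphereLaw k) ∧
    ∫ x : ℝ, (x : ℂ) ^ t ∂(onePlusSphereLaw k) =
      2 ^ t * ((Complex.Gamma (((k : ℂ) - 1) / 2 + t) / Complex.Gamma (((k : ℂ) - 1) / 2)) /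
        (Complex.Gamma ((k : ℂ) - 1 + t) / Complex.Gamma ((k : ℂ) - 1))) := by
  have ha := half_sub_one_pos hk
  have hk' : (2 : ℝ) ≤ k := by exact_mod_cast hk
  obtain ⟨h1, h2⟩ := cpow_betaMeasure ha ha (t := t) (by linarith)
  have hmeas : ∀ τ : Measure ℝ, AEStronglyMeasurable (fun x : ℝ => (x : ℂ) ^ t) τ := fun τ =>
    Measurable.aestronglyMeasurable (by fun_prop)
  have hcongr : (fun x : ℝ => ((2 * x : ℝ) : ℂ) ^ t) =ᵐ[betaMeasure (((k : ℝ) - 1) / 2)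
      (((k : ℝ) - 1) / 2)] fun x => (2 : ℂ) ^ t * (x : ℂ) ^ t := by
    filter_upwards [ae_betaMeasure_mem_Ioo] with x hx
    rw [Complex.ofReal_mul, Complex.mul_cpow_ofReal_nonneg zero_le_two hx.1.le]
    simp
  constructor
  · rw [onePlusSphereLaw, integrable_map_measure (hmeas _) (by fun_prop)]
    exact (h1.const_mul _).congr hcongr.symm
  · rw [onePlusSphereLaw, integral_map (by fun_prop) (hmeas _), integral_congr_ae hcongr,
      integral_const_mul, h2]
    push_cast
    rw [add_halves]
    congr 1
    rw [div_div_div_eq]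

end OnePlusSphereLaw

/-! ### Complex moments of det(1 + S). -/

namespace RotationGroup

theorem map_one_add_apply {N : ℕ} (hN : 2 ≤ N) [MeasurableSpace (RotationGroup N)]
    [BorelSpace (RotationGroup N)] (μ : Measure (RotationGroup N)) [μ.IsMulLeftInvariant]
    [IsProbabilityMeasure μ] (i : Fin N) :
    μ.map (fun S => 1 + S.1 i i) = onePlusSphereLaw N := by
  rw [← (hasSphereMoments_map_apply μ hN i).map_one_add hN,
    Measure.map_map (by fun_prop) (continuous_apply i i).measurable]
  rfl

/-- Nonnegativity is needed later because (x y)^t = x^t y^t may fail for complex t when the factors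
are negative. -/
theorem detOneAdd_nonneg {N : ℕ} (S : RotationGroup N) : 0 ≤ detOneAdd S := by
  induction N with
  | zero => simp [detOneAdd]
  | succ N ih =>
    obtain ⟨S', h⟩ := exists_detOneAdd_mul_extend (S * (extend 1)⁻¹)
    have h1 := h 1
    rw [inv_mul_cancel_right] at h1
    rw [h1]
    refine mul_nonneg ?_ (ih _)
    have := (abs_le.mp (abs_apply_le_one (S * (extend 1)⁻¹) (Fin.last N) (Fin.last N))).1
    linarith

theorem exists_abs_detOneAdd_le (N : ℕ) : ∃ C, ∀ S : RotationGroup N, |detOneAdd S| ≤ C := by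
  obtain ⟨C, hC⟩ := isCompact_univ.exists_bound_of_continuousOn
    (continuous_detOneAdd (N := N)).continuousOn
  exact ⟨C, fun S => hC S (Set.mem_univ S)⟩

theorem detOneAdd_one (S : RotationGroup 1) : detOneAdd S = 2 := by
  have h := (mem_specialOrthogonalGroup_iff_mul_transpose.mp S.2).2
  rw [Matrix.det_fin_one] at h
  rw [detOneAdd, Matrix.det_fin_one, Matrix.add_apply, h]
  norm_num

theorem cpow_detOneAdd (M : ℕ) [mM : MeasurableSpace (RotationGroup (M + 1))]
    [bM : BorelSpace (RotationGroup (M + 1))] (μ : Measure (RotationGroup (M + 1)))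
    [iμ : μ.IsMulLeftInvariant] [pμ : IsProbabilityMeasure μ] {t : ℂ} (ht : -1 / 2 < t.re) :
    Integrable (fun y : ℝ => (y : ℂ) ^ t) (μ.map detOneAdd) ∧
    ∫ y : ℝ, (y : ℂ) ^ t ∂(μ.map detOneAdd) =
      2 ^ t * ∏ k ∈ Finset.range M, ∫ x : ℝ, (x : ℂ) ^ t ∂(onePlusSphereLaw (k + 2)) := by
  have hd : ∀ {N : ℕ} [MeasurableSpace (RotationGroup N)] [BorelSpace (RotationGroup N)],
      Measurable (detOneAdd (N := N)) := @fun _ _ _ => continuous_detOneAdd.measurable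
  have hmeas : ∀ τ : Measure ℝ, AEStronglyMeasurable (fun x : ℝ => (x : ℂ) ^ t) τ := fun τ =>
    Measurable.aestronglyMeasurable (by fun_prop)
  induction M generalizing mM bM with
  | zero =>
    have : μ.map detOneAdd = Measure.dirac 2 := by
      have : (detOneAdd : RotationGroup 1 → ℝ) = fun _ => 2 := funext detOneAdd_one
      rw [this, Measure.map_const]
      simp
    rw [this]
    refine ⟨integrable_dirac (by simp), ?_⟩
    simp
  | succ M ih =>
    let _ : MeasurableSpace (RotationGroup (M + 1)) := borel _
    have : BorelSpace (RotationGroup (M + 1)) := ⟨rfl⟩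
    -- Normalising on the compact set `⊤`, the whole group, makes this a probability measure.
    let ν : Measure (RotationGroup (M + 1)) := Measure.haarMeasure ⊤
    have hν : IsProbabilityMeasure ν := ⟨Measure.haarMeasure_self (K₀ := ⊤)⟩
    obtain ⟨i1, e1⟩ := ih ν
    obtain ⟨i2, e2⟩ := cpow_onePlusSphereLaw (k := M + 2) (by omega) ht
    have := isProbabilityMeasure_onePlusSphereLaw (k := M + 2) (by omega)
    have hν' : IsProbabilityMeasure (ν.map detOneAdd) :=
      Measure.isProbabilityMeasure_map hd.aemeasurable
    have hν0 : ∀ᵐ y ∂(ν.map detOneAdd), 0 ≤ y := by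
      rw [ae_map_iff hd.aemeasurable measurableSet_Ici]
      exact .of_forall detOneAdd_nonneg
    rw [map_detOneAdd_succ μ ν, map_one_add_apply (by omega) μ, Measure.mconv]
    have hcongr : (fun z : ℝ × ℝ => ((z.1 * z.2 : ℝ) : ℂ) ^ t) =ᵐ[(onePlusSphereLaw (M + 2)).prod
        (ν.map detOneAdd)] fun z => (z.1 : ℂ) ^ t * (z.2 : ℂ) ^ t := by
      filter_upwards [Measure.quasiMeasurePreserving_fst.ae ae_onePlusSphereLaw_mem_Icc,
        Measure.quasiMeasurePreserving_snd.ae hν0] with z h1 h2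
      rw [Complex.ofReal_mul, Complex.mul_cpow_ofReal_nonneg h1.1 h2]
    constructor
    · rw [integrable_map_measure (hmeas _) (by fun_prop)]
      exact (i2.mul_prod i1).congr hcongr.symm
    · rw [integral_map (by fun_prop) (hmeas _), integral_congr_ae hcongr,
        integral_prod_mul (fun x : ℝ => (x : ℂ) ^ t) (fun x : ℝ => (x : ℂ) ^ t), e1,
        Finset.prod_range_succ]
      ring

end RotationGroup

/-! ### Products over independent pairs, and the collapse of the Gamma product. -/

theorem ProbabilityTheory.iIndepFun.integral_prod_comp_pair {ι Ω : Type*} [DecidableEq ι]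
    [MeasurableSpace Ω] {P : Measure Ω} {ε β : ι → Ω → ℝ}
    (h : iIndepFun (Sum.elim ε β) P) (hε : ∀ i, AEMeasurable (ε i) P)
    (hβ : ∀ i, AEMeasurable (β i) P) {g : ℝ → ℝ → ℝ} (hg : Measurable fun z : ℝ × ℝ => g z.1 z.2)
    (s : Finset ι) :
    ∫ ω, ∏ i ∈ s, g (ε i ω) (β i ω) ∂P = ∏ i ∈ s, ∫ ω, g (ε i ω) (β i ω) ∂P := by
  have := h.isProbabilityMeasure
  have hm : ∀ i, AEMeasurable (fun ω => g (ε i ω) (β i ω)) P := fun i =>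
    hg.comp_aemeasurable ((hε i).prodMk (hβ i))
  have hsum : ∀ i, AEMeasurable (Sum.elim ε β i) P := by
    rintro (i | i)
    exacts [hε i, hβ i]
  induction s using Finset.induction_on with
  | empty => simp
  | insert k s hk ih =>
    simp_rw [Finset.prod_insert hk]
    rw [← ih]
    have hdisj : Disjoint ({Sum.inl k, Sum.inr k} : Finset (ι ⊕ ι)) (s.disjSum s) := by
      rw [Finset.disjoint_left]
      intro x hx
      simp only [Finset.mem_insert, Finset.mem_singleton] at hx
      rcases hx with rfl | rfl <;> simp [hk]
    have hind := h.indepFun_finset₀ _ _ hdisj hsum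
    have hgm : ∀ {T : Finset (ι ⊕ ι)} (a b : T), Measurable fun u : T → ℝ => g (u a) (u b) :=
      fun {T} a b => by
        change Measurable ((fun z : ℝ × ℝ => g z.1 z.2) ∘ fun u : T → ℝ => (u a, u b))
        exact hg.comp ((measurable_pi_apply a).prodMk (measurable_pi_apply b))
    have hind' := hind.comp
      (φ := fun u => g (u ⟨Sum.inl k, by simp⟩) (u ⟨Sum.inr k, by simp⟩))
      (ψ := fun u => ∏ j ∈ s.attach,
        g (u ⟨Sum.inl j.1, by simp⟩) (u ⟨Sum.inr j.1, by simp⟩))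
      (hgm _ _) (Finset.measurable_fun_prod _ fun j _ => hgm _ _)
    have hind'' : IndepFun (fun ω => g (ε k ω) (β k ω))
        (fun ω => ∏ i ∈ s, g (ε i ω) (β i ω)) P := by
      have hp : (fun ω => ∏ i ∈ s, g (ε i ω) (β i ω)) =
          fun ω => ∏ i ∈ s.attach, g (ε i ω) (β i ω) :=
        funext fun ω => (Finset.prod_attach s fun i => g (ε i ω) (β i ω)).symm
      rw [hp]
      exact hind'
    exact hind''.integral_fun_mul_eq_mul_integral (hm k).aestronglyMeasurable
      (Finset.aemeasurable_fun_prod _ fun i _ => hm i).aestronglyMeasurable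

/-- Among the numerators, the integer arguments 1, ..., m cancel the first m denominators; the
half-integer ones remain. It is applied to f(z) = Γ(z + t)/Γ(z). -/
theorem prod_range_div_duplication {K : Type*} [Field K] {f : ℝ → K}
    (hf : ∀ x, 1 ≤ x → f x ≠ 0) (m : ℕ) :
    ∏ i ∈ Finset.range (2 * m + 1), f ((i + 1) / 2) / f (i + 1) =
      ∏ k ∈ Finset.range (m + 1), f (k + 1 / 2) / f (m + k + 1) := by
  have h1 : ∏ i ∈ Finset.range (2 * m + 1), f ((i + 1) / 2) =
      (∏ k ∈ Finset.range m, f (k + 1)) * ∏ k ∈ Finset.range (m + 1), f (k + 1 / 2) := by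
    induction m with
    | zero => simp
    | succ m ih =>
      rw [show 2 * (m + 1) + 1 = 2 * m + 1 + 1 + 1 by ring, Finset.prod_range_succ,
        Finset.prod_range_succ, ih]
      simp only [Finset.prod_range_succ]
      push_cast
      rw [show (2 * (m : ℝ) + 1 + 1) / 2 = m + 1 by ring,
        show (2 * (m : ℝ) + 2 + 1) / 2 = m + 1 + 1 / 2 by ring]
      ring
  have h2 : ∏ i ∈ Finset.range (2 * m + 1), f (i + 1) =
      (∏ k ∈ Finset.range m, f (k + 1)) * ∏ k ∈ Finset.range (m + 1), f (m + k + 1) := by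
    rw [show 2 * m + 1 = m + (m + 1) by ring, Finset.prod_range_add]
    push_cast
    rfl
  rw [Finset.prod_div_distrib, Finset.prod_div_distrib, h1, h2, mul_div_mul_left]
  exact Finset.prod_ne_zero_iff.mpr fun k _ => hf _ (by simp)

namespace RotationGroup

theorem neg_one_mem (n : ℕ) :
    (-1 : Matrix (Fin (2 * n)) (Fin (2 * n)) ℝ) ∈ Matrix.specialOrthogonalGroup (Fin (2 * n)) ℝ := by
  rw [mem_specialOrthogonalGroup_iff_mul_transpose]
  simp [Matrix.det_neg]

theorem continuous_det_one_sub {N : ℕ} :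
    Continuous fun S : RotationGroup N => (1 - S.1).det := by
  fun_prop

/-- Left translation by -1, which has determinant 1 in even dimension, preserves μ and exchanges the
two determinants. -/
theorem map_det_one_sub {n : ℕ} [MeasurableSpace (RotationGroup (2 * n))]
    [BorelSpace (RotationGroup (2 * n))] (μ : Measure (RotationGroup (2 * n)))
    [μ.IsMulLeftInvariant] : μ.map (fun S => (1 - S.1).det) = μ.map detOneAdd := by
  conv_rhs => rw [← map_mul_left_eq_self μ ⟨-1, neg_one_mem n⟩]
  rw [Measure.map_map continuous_detOneAdd.measurable (by fun_prop)]
  congr 1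
  ext S
  simp [detOneAdd, sub_eq_add_neg]

end RotationGroup

theorem map_one_add_sign_mul_sqrt {Ω : Type*} [MeasurableSpace Ω] {P : Measure Ω}
    [IsProbabilityMeasure P] {ε β : Ω → ℝ} {k : ℕ} (hk : 2 ≤ k) (hε : AEMeasurable ε P)
    (h1 : P {ω | ε ω = 1} = 1 / 2) (h2 : P {ω | ε ω = -1} = 1 / 2)
    (hβ : HasLaw β (betaMeasure (1 / 2) (((k : ℝ) - 1) / 2)) P) (hi : IndepFun ε β P) :
    P.map (fun ω => 1 + ε ω * √(β ω)) = onePlusSphereLaw k := by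
  have h := hasSphereMoments_map_sign_mul_sqrt (half_sub_one_pos hk) hε h1 h2 hβ hi
  rw [mul_div_cancel₀ _ two_ne_zero, add_sub_cancel] at h
  have hβm := hβ.aemeasurable
  rw [← h.map_one_add hk, AEMeasurable.map_map_of_aemeasurable (by fun_prop) (by fun_prop)]
  rfl

theorem prod_Icc_two_eq_prod_range {M : Type*} [CommMonoid M] (m : ℕ) (f : ℕ → M) :
    ∏ k ∈ Finset.Icc 2 (m + 1), f k = ∏ k ∈ Finset.range m, f (k + 2) := by
  rw [show Finset.Icc 2 (m + 1) = Finset.Ico 2 (m + 2) by ext; simp; omega,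
    Finset.prod_Ico_eq_prod_range]
  simp [add_comm]

theorem prod_moments_onePlusSphereLaw (m : ℕ) {t : ℂ} (ht : -1 / 2 < t.re) :
    2 ^ t * ∏ k ∈ Finset.range (2 * m + 1), ∫ x : ℝ, (x : ℂ) ^ t ∂(onePlusSphereLaw (k + 2)) =
      (2 : ℂ) ^ (2 * ((m + 1 : ℕ) : ℂ) * t) *
        ∏ k ∈ Finset.Icc 1 (m + 1),
          (Complex.Gamma (((m + 1 : ℕ) : ℂ) + k - 1) * Complex.Gamma (t + k - 1 / 2)) /
            (Complex.Gamma ((k : ℂ) - 1 / 2) * Complex.Gamma (t + k + ((m + 1 : ℕ) : ℂ) - 1)) := by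
  set f : ℝ → ℂ := fun z => Complex.Gamma (z + t) / Complex.Gamma z with hf
  have hf0 : ∀ x, 1 ≤ x → f x ≠ 0 := by
    intro x hx
    refine div_ne_zero (Complex.Gamma_ne_zero_of_re_pos ?_) (Complex.Gamma_ne_zero_of_re_pos ?_)
    · simp only [Complex.add_re, Complex.ofReal_re]; linarith
    · rw [Complex.ofReal_re]; linarith
  have h1 : ∀ k : ℕ, ∫ x : ℝ, (x : ℂ) ^ t ∂(onePlusSphereLaw (k + 2)) =
      2 ^ t * (f ((k + 1) / 2) / f (k + 1)) := by
    intro k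
    rw [(cpow_onePlusSphereLaw (k := k + 2) (by omega) ht).2, hf]
    push_cast
    rw [show (k + 2 - 1 : ℂ) = k + 1 by ring]
  simp_rw [h1]
  -- The 2m + 1 factors 2^t join the one from SO(1) to give exponent 2(m + 1)t.
  rw [Finset.prod_mul_distrib, Finset.prod_const, Finset.card_range,
    prod_range_div_duplication hf0, ← mul_assoc, ← pow_succ', ← Complex.cpow_nat_mul]
  congr 1
  · congr 2
    push_cast
    ring
  · rw [show Finset.Icc 1 (m + 1) = Finset.Ico 1 (m + 2) by ext; simp; omega,
      Finset.prod_Ico_eq_prod_range]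
    refine Finset.prod_congr rfl fun k _ => ?_
    rw [hf, div_div_div_eq]
    push_cast
    ring_nf

/-! ### The identity in law and the moment formula. -/

theorem corollary6p2 {n : ℕ} (hn : 1 ≤ n)
    -- `SO(2n)` with its Borel σ-algebra and its Haar probability measure `μ`
    [MeasurableSpace (Matrix.specialOrthogonalGroup (Fin (2 * n)) ℝ)]
    [BorelSpace (Matrix.specialOrthogonalGroup (Fin (2 * n)) ℝ)]
    (μ : Measure (Matrix.specialOrthogonalGroup (Fin (2 * n)) ℝ))
    [μ.IsHaarMeasure] [IsProbabilityMeasure μ]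
    -- a random matrix with law `μ`
    {Ω : Type*} [MeasurableSpace Ω] (P : Measure Ω) [IsProbabilityMeasure P]
    (SO : Ω → Matrix.specialOrthogonalGroup (Fin (2 * n)) ℝ) (hSO : HasLaw SO μ P) :
    -- the identity in law, for any family of variables as described, on any probability space
    (∀ {Ω' : Type*} [MeasurableSpace Ω'] (P' : Measure Ω') [IsProbabilityMeasure P']
        (ε β : ℕ → Ω' → ℝ),
        (∀ k ∈ Finset.Icc 2 (2 * n), AEMeasurable (ε k) P' ∧
          P' {ω | ε k ω = 1} = 1 / 2 ∧ P' {ω | ε k ω = -1} = 1 / 2) →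
        (∀ k ∈ Finset.Icc 2 (2 * n),
          HasLaw (β k) (betaMeasure (1 / 2) (((k : ℝ) - 1) / 2)) P') →
        iIndepFun (Sum.elim (fun k : Finset.Icc 2 (2 * n) => ε k)
          (fun k : Finset.Icc 2 (2 * n) => β k)) P' →
        IdentDistrib
          (fun ω => (1 - (SO ω : Matrix (Fin (2 * n)) (Fin (2 * n)) ℝ)).det)
          (fun ω => 2 * ∏ k ∈ Finset.Icc 2 (2 * n), (1 + ε k ω * √(β k ω)))
          P P') ∧
    -- the moments of the characteristic polynomial
    (∀ t : ℂ, -1 / 2 < t.re →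
      Integrable (fun ω =>
        (((1 - (SO ω : Matrix (Fin (2 * n)) (Fin (2 * n)) ℝ)).det : ℝ) : ℂ) ^ t) P ∧
      ∫ ω, (((1 - (SO ω : Matrix (Fin (2 * n)) (Fin (2 * n)) ℝ)).det : ℝ) : ℂ) ^ t ∂P =
        (2 : ℂ) ^ (2 * (n : ℂ) * t) *
          ∏ k ∈ Finset.Icc 1 n,
            (Complex.Gamma ((n : ℂ) + k - 1) * Complex.Gamma (t + k - 1 / 2)) /
              (Complex.Gamma ((k : ℂ) - 1 / 2) * Complex.Gamma (t + k + n - 1))) := by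
  obtain ⟨m, rfl⟩ : ∃ m, n = m + 1 := ⟨n - 1, by omega⟩
  have hlaw : HasLaw (fun ω => (1 - (SO ω).1).det) (μ.map RotationGroup.detOneAdd) P := by
    rw [← RotationGroup.map_det_one_sub]
    have hm := RotationGroup.continuous_det_one_sub (N := 2 * (m + 1)) |>.measurable
    refine ⟨hm.comp_aemeasurable hSO.aemeasurable, ?_⟩
    rw [← hSO.map_eq, AEMeasurable.map_map_of_aemeasurable hm.aemeasurable hSO.aemeasurable]
    rfl
  have hmeas : ∀ (t : ℂ) (τ : Measure ℝ), AEStronglyMeasurable (fun x : ℝ => (x : ℂ) ^ t) τ :=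
    fun t τ => Measurable.aestronglyMeasurable (by fun_prop)
  have hmom : ∀ t : ℂ, -1 / 2 < t.re →
      Integrable (fun y : ℝ => (y : ℂ) ^ t) (μ.map RotationGroup.detOneAdd) ∧
      ∫ y : ℝ, (y : ℂ) ^ t ∂(μ.map RotationGroup.detOneAdd) = 2 ^ t *
        ∏ k ∈ Finset.range (2 * m + 1), ∫ x : ℝ, (x : ℂ) ^ t ∂(onePlusSphereLaw (k + 2)) :=
    fun t ht => RotationGroup.cpow_detOneAdd (2 * m + 1) μ ht
  refine ⟨?_, fun t ht => ?_⟩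
  · intro Ω' _ P' _ ε β hε hβ hind
    have hβm : ∀ k ∈ Finset.Icc 2 (2 * (m + 1)), AEMeasurable (β k) P' := fun k hk =>
      (hβ k hk).aemeasurable
    have hXm : ∀ k ∈ Finset.Icc 2 (2 * (m + 1)),
        AEMeasurable (fun ω => 1 + ε k ω * √(β k ω)) P' := fun k hk =>
      (((hε k hk).1.mul (hβm k hk).sqrt)).const_add 1
    have hX : ∀ k ∈ Finset.Icc 2 (2 * (m + 1)),
        P'.map (fun ω => 1 + ε k ω * √(β k ω)) = onePlusSphereLaw k := by
      intro k hk
      refine map_one_add_sign_mul_sqrt (Finset.mem_Icc.mp hk).1 (hε k hk).1 (hε k hk).2.1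
        (hε k hk).2.2 (hβ k hk) ?_
      exact hind.indepFun (i := Sum.inl ⟨k, hk⟩) (j := Sum.inr ⟨k, hk⟩) (by simp)
    have hYm : AEMeasurable
        (fun ω => 2 * ∏ k ∈ Finset.Icc 2 (2 * (m + 1)), (1 + ε k ω * √(β k ω))) P' :=
      (Finset.aemeasurable_fun_prod _ hXm).const_mul 2
    refine ⟨hlaw.aemeasurable, hYm, ?_⟩
    rw [hlaw.map_eq]
    have hP1 : IsProbabilityMeasure (μ.map RotationGroup.detOneAdd) :=
      Measure.isProbabilityMeasure_map RotationGroup.continuous_detOneAdd.measurable.aemeasurable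
    have hP2 := Measure.isProbabilityMeasure_map hYm
    obtain ⟨C, hC⟩ := RotationGroup.exists_abs_detOneAdd_le (2 * (m + 1))
    set C' : ℝ := 2 * ∏ k ∈ Finset.Icc 2 (2 * (m + 1)), 2 with hC'
    -- C bounds the determinant by compactness; C' bounds the product because each factor lies
    -- almost surely in [0, 2].
    refine Measure.ext_of_forall_integral_pow_eq (R := max C C') ?_ ?_ fun p => ?_
    · rw [ae_map_iff RotationGroup.continuous_detOneAdd.measurable.aemeasurable
        (measurableSet_le (by fun_prop) (by fun_prop))]
      exact .of_forall fun S => (hC S).trans (le_max_left _ _)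
    · rw [ae_map_iff hYm (measurableSet_le (by fun_prop) (by fun_prop))]
      have hae : ∀ᵐ ω ∂P', ∀ k ∈ Finset.Icc 2 (2 * (m + 1)),
          1 + ε k ω * √(β k ω) ∈ Set.Icc (0 : ℝ) 2 := by
        refine (Filter.eventually_all_finset _).mpr fun k hk => ?_
        have h := ae_onePlusSphereLaw_mem_Icc (k := k)
        rw [← hX k hk] at h
        exact ae_of_ae_map (hXm k hk) h
      filter_upwards [hae] with ω hω
      refine le_trans ?_ (le_max_right _ _)
      rw [abs_mul, Finset.abs_prod, abs_two, hC']
      gcongr with k hk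
      rw [abs_of_nonneg (hω k hk).1]
      exact (hω k hk).2
    -- Integer moments of the determinant are its complex moments at t = p.
    · have hre : -1 / 2 < (p : ℂ).re := by
        rw [Complex.natCast_re]
        have : (0 : ℝ) ≤ p := p.cast_nonneg
        linarith
      have h1 := (hmom p hre).2
      rw [integral_map hYm (by fun_prop)]
      have h2 : ∫ ω, (2 * ∏ k ∈ Finset.Icc 2 (2 * (m + 1)), (1 + ε k ω * √(β k ω))) ^ p ∂P' =
          2 ^ p * ∏ k ∈ Finset.Icc 2 (2 * (m + 1)), ∫ x, x ^ p ∂(onePlusSphereLaw k) := by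
        have h3 := hind.integral_prod_comp_pair (fun i => (hε i i.2).1) (fun i => hβm i i.2)
          (g := fun x y => (1 + x * √y) ^ p) (by fun_prop) Finset.univ
        simp_rw [mul_pow, ← Finset.prod_pow]
        rw [integral_const_mul]
        congr 1
        have h4 : ∀ ω, ∏ k ∈ Finset.Icc 2 (2 * (m + 1)), (1 + ε k ω * √(β k ω)) ^ p =
            ∏ k : Finset.Icc 2 (2 * (m + 1)), (1 + ε k ω * √(β k ω)) ^ p := fun ω =>
          (Finset.prod_coe_sort _ fun k => (1 + ε k ω * √(β k ω)) ^ p).symm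
        simp_rw [h4]
        rw [h3, Finset.prod_coe_sort (Finset.Icc 2 (2 * (m + 1)))
          (fun k => ∫ ω, (1 + ε k ω * √(β k ω)) ^ p ∂P')]
        refine Finset.prod_congr rfl fun k hk => ?_
        rw [← hX k hk, integral_map (hXm k hk) (by fun_prop)]
      rw [h2]
      refine Eq.trans ?_ (congrArg (2 ^ p * ·)
        (prod_Icc_two_eq_prod_range (2 * m + 1) fun k => ∫ x, x ^ p ∂(onePlusSphereLaw k)).symm)
      simp only [Complex.cpow_natCast, ← Complex.ofReal_pow, integral_complex_ofReal] at h1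
      exact_mod_cast h1
  · obtain ⟨h1, h2⟩ := hmom t ht
    rw [← hlaw.map_eq] at h1 h2
    rw [integral_map hlaw.aemeasurable (hmeas t _), prod_moments_onePlusSphereLaw m ht] at h2
    rw [integrable_map_measure (hmeas t _) hlaw.aemeasurable] at h1
    exact ⟨h1, h2⟩
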